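/- Assume TT: there exists an infinite torsion-free abelian countably compact topological group without non-trivial convergent sequences (every convergent sequence in it is eventually constant). Then there exists a free abelian group $G$, written additively, with a topology $\sigma$ such that $(G,\sigma)$ is a paratopological group (that is, the addition $G\times G\to G$ is continuous), $(G,\sigma)$ is functionally Hausdorff (any two distinct points are separated by a continuous real-valued function on $G$) and countably compact (every infinite subset $B$ has a point each of whose neighborhoods contains infinitely many points of $B$), but $(G,\sigma)$ is not a topological group (the inverse $x\mapsto -x$ is not continuous). Moreover, $(G,\sigma)$ is not left $\omega$-precompact: there is a neighborhood $U$ of $0$ such that $F+U\ne G$ for every countable $F\subset G$. -/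

import Mathlib

open Set Filter Topology
open scoped Pointwise

universe u v

/-- The axiomatic assumption TT: there is an infinite torsion-free abelian countably compact
topological group without non-trivial convergent sequences, that is, such that every convergent
sequence is eventually constant. (The Hausdorff property is not listed because it follows: in a
torsion-free group that is not Hausdorff, the closure of zero is an infinite indiscrete subgroup,
in which every sequence converges.) -/
def TT : Prop :=
  ∃ (H : Type u) (_ : AddCommGroup H) (_ : TopologicalSpace H),
    IsTopologicalAddGroup H ∧ Infinite H ∧ IsAddTorsionFree H ∧ CountablyCompactSpace H ∧
      ∀ (x : ℕ → H) (a : H), Tendsto x atTop (𝓝 a) → EventuallyConst x atTop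

/-- A space is functionally Hausdorff if any two distinct points are separated by a continuous
real-valued function. -/
def FunctionallyHausdorff (X : Type*) [TopologicalSpace X] : Prop :=
  ∀ x y : X, x ≠ y → ∃ f : X → ℝ, Continuous f ∧ f x ≠ f y

/-- A (paratopological) group is left `ω`-precompact if for each neighborhood `U` of the unit
there is a countable set `F` with `F + U` equal to the whole group. -/
def LeftOmegaPrecompact (G : Type*) [AddGroup G] [TopologicalSpace G] : Prop :=
  ∀ U ∈ 𝓝 (0 : G), ∃ F : Set G, F.Countable ∧ F + U = univ

/-!
Let `H` be a group as in `TT`. It is Hausdorff, because two inseparable points would give an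
alternating convergent sequence. In `H` every injective sequence has continuum many cluster points
(`exists_injective_mapClusterPt`): a sequence never converges to its cluster point, hence splits
into two infinite parts with disjoint closed hulls, and iterating the splitting produces a Cantor
scheme with a cluster point on each branch.

The group `G` is the free abelian group over a well-ordered set `I` of the order type of the
continuum. There are only continuum many sequences in `G`, and since the continuum has uncountable
cofinality they can be listed along `I` so that each sequence appears at an index above all
the supports of its terms (`exists_index`). By transfinite recursion choose `x i ∈ H` to be a
cluster point of the image of the sequence listed at `i`, with no non-zero multiple in the span of
the earlier elements (`exists_independent_clusterPt`). This is possible since `H` is torsion-free: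
fewer than continuum many elements of `H` have a non-zero multiple in that span. The elements `x i`
are then independent, so `G` embeds in `H`.

Order `G` colexicographically, that is, by the sign of the coefficient at the largest index, and
refine the topology pulled back from `H` by declaring all sets `Iic g` to be open (`coneTopology`).
Addition stays continuous because it is monotone, but inversion does not, as it turns `Iic 0` into
`Ici 0`. The topology is finer than a Hausdorff group topology, so it is functionally Hausdorff. An
injective sequence listed at `i` lies entirely below the `i`-th basis vector, which is a cluster
point of it in the pulled-back topology and therefore also in the finer one; this is countable
compactness. In the same way every countable set `F` lies strictly below some element, which
is not in `F + Iic 0`.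
-/

/-! ### Cluster points of sequences -/

/-- In a countably compact `T₃` space without non-trivial convergent sequences, every infinite set
of indices of an injective sequence contains two infinite parts along which the sequence stays in
disjoint closed sets: along the given set the sequence has a cluster point, to which it does not
converge. -/
lemma exists_split {X : Type u} [TopologicalSpace X] [T3Space X] [CountablyCompactSpace X]
    (hX : ∀ (x : ℕ → X) (a : X), Tendsto x atTop (𝓝 a) → EventuallyConst x atTop)
    {s : ℕ → X} (hs : Function.Injective s) (A : Set ℕ) (hA : A.Infinite) :
    ∃ (B : Bool → Set ℕ) (C : Bool → Set X), Disjoint (C true) (C false) ∧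
      ∀ b, (B b).Infinite ∧ B b ⊆ A ∧ IsClosed (C b) ∧ MapsTo s (B b) (C b) := by
  obtain ⟨g, hg, hgA⟩ := extraction_of_frequently_atTop (Nat.frequently_atTop_iff_infinite.2 hA)
  obtain ⟨p, -, hp⟩ := CountablyCompactSpace.isCountablyCompact_univ.seq_clusterPt (s ∘ g) (by simp)
  have hinj : Function.Injective (s ∘ g) := hs.comp hg.injective
  have hnt : ¬ Tendsto (s ∘ g) atTop (𝓝 p) := by
    intro h
    obtain ⟨n, hn⟩ := eventuallyConst_atTop.1 (hX _ _ h)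
    have := hinj (hn (n + 1) (by omega))
    omega
  obtain ⟨U, hU, hUn⟩ : ∃ U ∈ 𝓝 p, ∃ᶠ n in atTop, s (g n) ∉ U := by
    simpa [Tendsto, Filter.le_def, Filter.Frequently] using hnt
  obtain ⟨K, hK, hKc, hKU⟩ := exists_mem_nhds_isClosed_subset (interior_mem_nhds.2 hU)
  have hinf : ∀ P : X → Prop, (∃ᶠ n in atTop, P (s (g n))) → {m ∈ A | P (s m)}.Infinite := by
    intro P hP
    refine ((Nat.frequently_atTop_iff_infinite.1 hP).image hg.injective.injOn).mono ?_
    rintro _ ⟨n, hn, rfl⟩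
    exact ⟨hgA n, hn⟩
  refine ⟨fun b => cond b {m ∈ A | s m ∈ K} {m ∈ A | s m ∉ U},
    fun b => cond b K (interior U)ᶜ, disjoint_compl_right_iff_subset.2 hKU, ?_⟩
  rintro (_ | _)
  · exact ⟨hinf (· ∉ U) hUn, sep_subset _ _, isOpen_interior.isClosed_compl,
      fun m hm h => hm.2 (interior_subset h)⟩
  · exact ⟨hinf (· ∈ K) (hp.frequently hK), sep_subset _ _, hKc, fun m hm => hm.2⟩

/-- In a countably compact `T₃` space without non-trivial convergent sequences, an injective
sequence has at least continuum many cluster points. They are found along the branches of a Cantor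
scheme of infinite index sets: the diagonal sequence of a branch has a cluster point, and
two branches are told apart by the disjoint closed sets at the place where they split. -/
lemma exists_injective_mapClusterPt {X : Type u} [TopologicalSpace X] [T3Space X]
    [CountablyCompactSpace X]
    (hX : ∀ (x : ℕ → X) (a : X), Tendsto x atTop (𝓝 a) → EventuallyConst x atTop)
    {s : ℕ → X} (hs : Function.Injective s) :
    ∃ p : (ℕ → Bool) → X, Function.Injective p ∧ ∀ f, MapClusterPt (p f) atTop s := by
  choose B C hC hB using fun A : {A : Set ℕ // A.Infinite} => exists_split hX hs A.1 A.2
  let T (f : ℕ → Bool) : ℕ → {A : Set ℕ // A.Infinite} :=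
    Nat.rec ⟨univ, infinite_univ⟩ fun n A => ⟨B A (f n), (hB A (f n)).1⟩
  have hT (f : ℕ → Bool) (n : ℕ) : (T f (n + 1)).1 = B (T f n) (f n) := rfl
  have hTanti (f : ℕ → Bool) : Antitone fun n => (T f n).1 :=
    antitone_nat_of_succ_le fun n => (hB (T f n) (f n)).2.1
  have hdiag (f : ℕ → Bool) : ∃ g : ℕ → ℕ, StrictMono g ∧ ∀ n, g n ∈ (T f n).1 :=
    extraction_forall_of_frequently fun n => Nat.frequently_atTop_iff_infinite.2 (T f n).2
  choose g hg hgT using hdiag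
  choose p _ hp using fun f =>
    CountablyCompactSpace.isCountablyCompact_univ.seq_clusterPt (s ∘ g f) (by simp)
  have hpC (f : ℕ → Bool) (n : ℕ) : p f ∈ C (T f n) (f n) := by
    obtain ⟨-, -, hcl, hmaps⟩ := hB (T f n) (f n)
    by_contra hpf
    obtain ⟨m, hm, hnm⟩ :=
      (((hp f).frequently (hcl.isOpen_compl.mem_nhds hpf)).and_eventually
        (eventually_ge_atTop (n + 1))).exists
    exact hm (hmaps (hTanti f hnm (hgT f m)))
  refine ⟨p, fun f h hfh => ?_, fun f => (hp f).of_comp (hg f).tendsto_atTop⟩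
  by_contra hne
  have hex : ∃ n, f n ≠ h n := Function.ne_iff.1 hne
  classical
  have hmin (m : ℕ) (hm : m ≤ Nat.find hex) : T f m = T h m := by
    induction m with
    | zero => rfl
    | succ m ih =>
      have h1 : f m = h m := not_not.1 (Nat.find_min hex hm)
      apply Subtype.ext
      rw [hT, hT, ih (by omega), h1]
  have h1 := hpC f (Nat.find hex)
  have h2 := hpC h (Nat.find hex)
  rw [hmin _ le_rfl, hfh] at h1
  have h3 := Nat.find_spec hex
  have hd := Set.disjoint_left.1 (hC (T h (Nat.find hex)))
  generalize f (Nat.find hex) = a at *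
  generalize h (Nat.find hex) = b at *
  cases a <;> cases b
  · exact h3 rfl
  · exact hd h2 h1
  · exact hd h1 h2
  · exact h3 rfl

/-! ### The index set -/

open Cardinal in
/-- There is a well-ordered set `I` with initial segments of size less than continuum and an
enumeration by `I` of the sequences in the free abelian group over `I`, such that every sequence
appears at some index above the supports of all of its terms. -/
lemma exists_index : ∃ (I : Type v) (_ : LinearOrder I) (_ : WellFoundedLT I)
    (e : I → ℕ → I →₀ ℤ), (∀ i : I, #(Iio i) < 𝔠) ∧
      ∀ s : ℕ → I →₀ ℤ, ∃ i, e i = s ∧ ∀ n, ∀ j ∈ (s n).support, j < i := by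
  let I : Type v := (𝔠 : Cardinal.{v}).ord.ToType
  have hI : #I = 𝔠 := by simp [I]
  have : Infinite I := by rw [infinite_iff, hI]; exact aleph0_le_continuum
  have hord : (#I).ord = Ordinal.type (α := I) (· < ·) := by rw [hI, Ordinal.type_toType]
  have hlt (i : I) : #(Iio i) < 𝔠 := (mk_Iio_lt i hord).trans_eq hI
  have hle (i : I) : #(Iic i) < 𝔠 := by
    rw [← Iio_insert]
    exact mk_insert_le.trans_lt (add_lt_of_lt aleph0_le_continuum (hlt i)
      (one_lt_aleph0.trans_le aleph0_le_continuum))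
  -- Each sequence is listed continuum many times, by pairing it with an arbitrary index.
  have hS : #((ℕ → I →₀ ℤ) × I) = #I := by
    simp [hI, max_eq_left aleph0_le_continuum]
  obtain ⟨g⟩ := Cardinal.eq.1 hS
  refine ⟨I, inferInstance, inferInstance, fun i => (g.symm i).1, hlt, fun s => ?_⟩
  by_contra! hcon
  let J : Set I := ⋃ n, (s n).support
  have hJ : J.Countable := countable_iUnion fun n => (s n).support.countable_toSet
  have hsub : (univ : Set I) ⊆ ⋃ j : J, {i | g (s, i) ≤ j} := by
    intro i _
    obtain ⟨n, j, hj, hji⟩ := hcon (g (s, i)) (by simp)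
    exact mem_iUnion.2 ⟨⟨j, mem_iUnion.2 ⟨n, hj⟩⟩, hji⟩
  -- König's theorem: a countable union of sets of size less than `𝔠` has size less than `𝔠`.
  have hfib (j : J) : #{i | g (s, i) ≤ j} < 𝔠 := by
    refine (mk_le_of_injective (f := fun i : {i | g (s, i) ≤ j} => (⟨g (s, i), i.2⟩ : Iic j.1))
      fun a b hab => ?_).trans_lt (hle j)
    simpa [Subtype.ext_iff] using hab
  have h1 : 𝔠 ≤ Cardinal.sum fun j : J => #{i | g (s, i) ≤ j} :=
    (hI.symm.trans mk_univ.symm).trans_le <|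
      (mk_le_mk_of_subset hsub).trans mk_iUnion_le_sum_mk
  have h2 := sum_lt_prod _ _ hfib
  rw [prod_const'] at h2
  have h3 : 𝔠 ^ #J ≤ 𝔠 :=
    (power_le_power_left continuum_ne_zero (le_aleph0_iff_set_countable.2 hJ)).trans_eq
      continuum_power_aleph0
  exact (h1.trans_lt h2).not_ge h3

/-! ### Independent cluster points -/

/-- A family indexed by a linear order is independent over `ℤ` if no non-zero multiple of a member
lies in the span of the earlier ones. -/
lemma injOn_linearCombination_of_notMem_span {I : Type v} {H : Type u} [LinearOrder I]
    [AddCommGroup H] (x : I → H) (A : Set I)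
    (hx : ∀ i ∈ A, ∀ n : ℤ, n ≠ 0 → n • x i ∉ Submodule.span ℤ (x '' Iio i)) :
    InjOn (Finsupp.linearCombination ℤ x) (Finsupp.supported ℤ ℤ A) := by
  refine LinearMap.injOn_of_disjoint_ker subset_rfl (LinearMap.disjoint_ker.2 fun l hlA hl => ?_)
  by_contra hne
  have hsupp : l.support.Nonempty := Finsupp.support_nonempty_iff.2 hne
  set i := l.support.max' hsupp
  have hi : l i ≠ 0 := Finsupp.mem_support_iff.1 (l.support.max'_mem hsupp)
  apply hx i (hlA (l.support.max'_mem hsupp)) (-l i) (neg_ne_zero.2 hi)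
  rw [← Finsupp.single_add_erase i l, map_add, Finsupp.linearCombination_single] at hl
  rw [neg_smul, neg_eq_of_add_eq_zero_right hl, Finsupp.mem_span_image_iff_linearCombination]
  refine ⟨l.erase i, ?_, rfl⟩
  rw [Finsupp.mem_supported]
  intro j hj
  simp only [Finsupp.support_erase, Finset.coe_erase] at hj
  exact lt_of_le_of_ne (l.support.le_max' j hj.1) hj.2

open Cardinal in
/-- In a torsion-free group, fewer than continuum many elements have a non-zero multiple in
the span of fewer than continuum many elements, since division by an integer is unique. So
one of continuum many given elements has no such multiple. -/
lemma exists_notMem_span {K : Type v} {H : Type u} [AddCommGroup H] [IsAddTorsionFree H]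
    (y : K → H) (hK : #K < 𝔠) (p : (ℕ → Bool) → H) (hp : Function.Injective p) :
    ∃ f, ∀ n : ℤ, n ≠ 0 → n • p f ∉ Submodule.span ℤ (range y) := by
  by_contra! hcon
  choose n hn hmem using hcon
  choose l hl using fun f => (Finsupp.mem_span_range_iff_exists_finsupp.1 (hmem f))
  have hinj : Function.Injective fun f => (n f, l f) := by
    intro f h hfh
    rw [Prod.mk.injEq] at hfh
    apply hp
    have h1 := hl h
    rw [← hfh.2, hl f, ← hfh.1] at h1
    exact zsmul_right_injective (hn f) h1
  have h1 := lift_mk_le_lift_mk_of_injective hinj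
  have h2 : #(ℤ × (K →₀ ℤ)) < 𝔠 := by
    rcases isEmpty_or_nonempty K with hE | hE
    · simp [aleph0_lt_continuum]
    · have := max_lt hK aleph0_lt_continuum
      simpa [aleph0_lt_continuum] using this
  have h3 : lift.{v} #(ℕ → Bool) = 𝔠 := by simp
  rw [h3, lift_uzero] at h1
  exact (h1.trans_lt h2).false

/-- Transfinite recursion: at each step the new element is chosen as a cluster point
of the prescribed sequence of combinations of earlier ones, outside the few elements
that depend on the earlier ones. -/
lemma exists_independent_clusterPt {I : Type v} [LinearOrder I] [WellFoundedLT I]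
    (hI : ∀ i : I, Cardinal.mk (Iio i) < Cardinal.continuum) (e : I → ℕ → I →₀ ℤ)
    {H : Type u} [AddCommGroup H] [IsAddTorsionFree H] [TopologicalSpace H] [Infinite H]
    [T3Space H] [CountablyCompactSpace H]
    (hH : ∀ (x : ℕ → H) (a : H), Tendsto x atTop (𝓝 a) → EventuallyConst x atTop) :
    ∃ x : I → H, Function.Injective (Finsupp.linearCombination ℤ x) ∧
      ∀ i, Function.Injective (e i) → (∀ n, ∀ j ∈ (e i n).support, j < i) →
        MapClusterPt (x i) atTop fun n => Finsupp.linearCombination ℤ x (e i n) := by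
  classical
  -- `Good i y p`: the element `p` may be put at `i`, after the part of the family `y` below `i`.
  let Good (i : I) (y : I → H) (p : H) : Prop :=
    (∀ n : ℤ, n ≠ 0 → n • p ∉ Submodule.span ℤ (y '' Iio i)) ∧
      (Function.Injective (e i) → (∀ n, ∀ j ∈ (e i n).support, j < i) →
        MapClusterPt p atTop fun n => Finsupp.linearCombination ℤ y (e i n))
  have hcongr {i : I} {y z : I → H} {p : H} (hyz : EqOn y z (Iio i)) (h : Good i y p) :
      Good i z p := by
    refine ⟨hyz.image_eq ▸ h.1, fun h1 h2 => ?_⟩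
    convert h.2 h1 h2 using 2 with n
    rw [Finsupp.linearCombination_apply, Finsupp.linearCombination_apply]
    exact Finsupp.sum_congr fun j hj => by rw [hyz (h2 n j hj)]
  let ext (i : I) (y : ∀ j, j < i → H) (j : I) : H := if h : j < i then y j h else 0
  let x : I → H := WellFounded.fix (r := (· < ·)) wellFounded_lt
    fun i y => if h : ∃ p, Good i (ext i y) p then h.choose else 0
  have hext (i : I) : EqOn (ext i fun j _ => x j) x (Iio i) := fun j hj => dif_pos hj
  have hx (i : I) : x i = if h : ∃ p, Good i (ext i fun j _ => x j) p then h.choose else 0 :=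
    WellFounded.fix_eq _ _ _
  have hstep (i : I) (h : ∃ p, Good i x p) : Good i x (x i) := by
    have h' : ∃ p, Good i (ext i fun j _ => x j) p :=
      h.imp fun p hp => hcongr (hext i).symm hp
    rw [hx i, dif_pos h']
    exact hcongr (hext i) h'.choose_spec
  have hgood (i : I) : Good i x (x i) := by
    induction i using WellFoundedLT.induction with
    | ind i ih =>
      apply hstep
      -- If the sequence listed at `i` is not to be considered, any injective sequence will do.
      obtain ⟨s, hs, hes⟩ : ∃ s : ℕ → H, Function.Injective s ∧ (Function.Injective (e i) →
          (∀ n, ∀ j ∈ (e i n).support, j < i) →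
          s = fun n => Finsupp.linearCombination ℤ x (e i n)) := by
        by_cases h : Function.Injective (e i) ∧ ∀ n, ∀ j ∈ (e i n).support, j < i
        · exact ⟨_, fun m n hmn => h.1 <| injOn_linearCombination_of_notMem_span x (Iio i)
            (fun j hj => (ih j hj).1) (h.2 m) (h.2 n) hmn, fun _ _ => rfl⟩
        · exact ⟨Infinite.natEmbedding H, (Infinite.natEmbedding H).injective,
            fun h1 h2 => (h ⟨h1, h2⟩).elim⟩
      obtain ⟨p, hp, hps⟩ := exists_injective_mapClusterPt hH hs
      obtain ⟨f, hf⟩ := exists_notMem_span (fun j : Iio i => x j) (hI i) p hp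
      exact ⟨p f, by rwa [image_eq_range], fun h1 h2 => hes h1 h2 ▸ hps f⟩
  refine ⟨x, fun l m h => ?_, fun i => (hgood i).2⟩
  exact injOn_linearCombination_of_notMem_span x univ (fun i _ => (hgood i).1)
    (by simp) (by simp) h

/-! ### Adding the order to a group topology -/

/-- The topology on `G` whose neighborhoods of `x` are generated by the sets `V ∩ Iic x`, where `V`
runs over the neighborhoods of `x` in the topology pulled back along `φ`. -/
abbrev coneTopology {G : Type v} {H : Type u} [AddCommGroup G] [Preorder G] [AddCommGroup H]
    [TopologicalSpace H] (φ : G →+ H) : TopologicalSpace G :=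
  TopologicalSpace.induced φ inferInstance ⊓ Topology.lowerSet G

section Cone

variable {G : Type v} {H : Type u} [AddCommGroup G] [PartialOrder G] [AddCommGroup H]
  [TopologicalSpace H] (φ : G →+ H)

lemma nhds_coneTopology (x : G) :
    @nhds G (coneTopology φ) x = comap φ (𝓝 (φ x)) ⊓ 𝓟 (Iic x) := by
  rw [nhds_inf, nhds_induced]
  congr 1
  let := Topology.lowerSet G
  exact Topology.IsLowerSet.nhds_eq_principal_Iic x

lemma continuous_coneTopology : @Continuous G H (coneTopology φ) _ φ :=
  continuous_inf_dom_left continuous_induced_dom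

lemma continuousAdd_coneTopology [IsOrderedAddMonoid G] [IsTopologicalAddGroup H] :
    @ContinuousAdd G (coneTopology φ) _ := by
  refine continuousAdd_inf (continuousAdd_induced φ) ?_
  let := Topology.lowerSet G
  refine ⟨continuous_iff_continuousAt.2 fun ⟨x, y⟩ => ?_⟩
  rw [ContinuousAt, nhds_prod_eq]
  simp only [Topology.IsLowerSet.nhds_eq_principal_Iic, prod_principal_principal]
  exact tendsto_principal_principal.2 fun z hz => add_le_add hz.1 hz.2

lemma functionallyHausdorff_coneTopology [IsTopologicalAddGroup H] [T0Space H]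
    (hφ : Function.Injective φ) :
    @FunctionallyHausdorff G (coneTopology φ) := by
  intro x y hxy
  let := IsTopologicalAddGroup.rightUniformSpace H
  obtain ⟨f, hf, hx, hy⟩ := CompletelyRegularSpace.completely_regular (φ x) {φ y} isClosed_singleton
    (by simpa using hφ.ne hxy)
  let := coneTopology φ
  have hc : Continuous φ := continuous_coneTopology φ
  refine ⟨fun z => f (φ z), by fun_prop, ?_⟩
  have := hy rfl
  simp [hx, this]

lemma t1Space_coneTopology [T1Space H] (hφ : Function.Injective φ) :
    @T1Space G (coneTopology φ) := by
  let := coneTopology φ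
  have hc : Continuous φ := continuous_coneTopology φ
  refine ⟨fun x => ?_⟩
  simpa [← image_singleton, hφ.preimage_image] using (isClosed_singleton (x := φ x)).preimage hc

/-- If every injective sequence has in the pulled-back topology a cluster point that is an upper
bound of its terms, then this point is also a cluster point in the cone topology. -/
lemma countablyCompactSpace_coneTopology [T1Space H] (hφ : Function.Injective φ)
    (h : ∀ s : ℕ → G, Function.Injective s →
      ∃ x, (∀ n, s n ≤ x) ∧ MapClusterPt (φ x) atTop (φ ∘ s)) :
    @CountablyCompactSpace G (coneTopology φ) := by
  let := coneTopology φ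
  have := t1Space_coneTopology φ hφ
  rw [← isCountablyCompact_univ_iff, isCountablyCompact_iff_infinite_subset_has_accPt]
  intro B _ hB
  let s := hB.natEmbedding
  have hs : Function.Injective fun n => (s n : G) := Subtype.val_injective.comp s.injective
  obtain ⟨x, hsx, hx⟩ := h _ hs
  have hclus : MapClusterPt x atTop fun n => (s n : G) := by
    rw [mapClusterPt_iff_frequently]
    intro V hV
    rw [nhds_coneTopology, mem_inf_principal] at hV
    obtain ⟨W, hW, hWV⟩ := hV
    exact (hx.frequently hW).mono fun n hn => hWV hn (hsx n)
  refine ⟨x, mem_univ x, accPt_iff_clusterPt.2 (ClusterPt.mono hclus (le_inf ?_ ?_))⟩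
  · exact tendsto_principal.mpr <| Nat.cofinite_eq_atTop ▸
      ((Set.finite_singleton x).preimage hs.injOn).compl_mem_cofinite
  · exact tendsto_principal.mpr <| Eventually.of_forall fun n => (s n).2

/-- If inversion were continuous, then `{0} = Iic 0 ∩ Ici 0` would be open. -/
lemma not_isTopologicalAddGroup_coneTopology [IsOrderedAddMonoid G] [Infinite G]
    (hcc : @CountablyCompactSpace G (coneTopology φ)) :
    ¬ @IsTopologicalAddGroup G (coneTopology φ) _ := by
  intro htop
  let := coneTopology φ
  have h0 : Iic (0 : G) ∈ 𝓝 0 := by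
    rw [nhds_coneTopology]
    exact mem_inf_of_right (mem_principal_self _)
  have h1 : -Iic (0 : G) ∈ 𝓝 0 := by
    have := (continuous_neg (G := G)).tendsto 0
    rw [neg_zero] at this
    exact this h0
  have h2 : {(0 : G)} ∈ 𝓝 0 := by
    filter_upwards [h0, h1] with x hx hx'
    exact le_antisymm hx (by simpa using hx')
  have := discreteTopology_of_isOpen_singleton_zero (isOpen_singleton_iff_nhds_eq_pure _ |>.2 (by
    exact le_antisymm (le_pure_iff.2 h2) (pure_le_nhds _)))
  obtain ⟨x, -, hx⟩ := hcc.isCountablyCompact_univ.exists_accPt_of_infinite subset_rfl infinite_univ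
  rw [accPt_iff_nhds] at hx
  obtain ⟨y, hy, hyx⟩ := hx {x} (by simp)
  exact hyx hy.1

/-- The neighborhood `Iic 0` has no countable family of translates covering `G`. -/
lemma not_leftOmegaPrecompact_coneTopology [IsOrderedAddMonoid G]
    (h : ∀ s : ℕ → G, ∃ x, ∀ n, s n < x) :
    ¬ @LeftOmegaPrecompact G _ (coneTopology φ) := by
  let := coneTopology φ
  intro hG
  obtain ⟨F, hF, hFG⟩ := hG (Iic 0) (by
    rw [nhds_coneTopology]
    exact mem_inf_of_right (mem_principal_self _))
  rcases F.eq_empty_or_nonempty with rfl | hne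
  · rw [empty_add] at hFG
    exact empty_ne_univ hFG
  obtain ⟨s, rfl⟩ := hF.exists_eq_range hne
  obtain ⟨x, hx⟩ := h s
  obtain ⟨_, ⟨n, rfl⟩, u, hu, hxu⟩ := hFG.symm ▸ mem_univ x
  exact (hx n).not_ge (hxu ▸ add_le_of_nonpos_right hu)

end Cone

/-! ### The free abelian group with the colexicographic order -/

/-- A sequence of finitely supported functions whose supports lie below `i` lies, in
the colexicographic order, below the indicator of `i`. -/
lemma toColex_lt_single {I : Type v} [LinearOrder I] {l : I →₀ ℤ} {i : I}
    (h : ∀ j ∈ l.support, j < i) : toColex l < toColex (Finsupp.single i 1) := by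
  have hl (j : I) (hj : i ≤ j) : l j = 0 :=
    Finsupp.notMem_support_iff.1 fun hjs => (h j hjs).not_ge hj
  refine Finsupp.Colex.lt_iff.2 ⟨i, fun j hj => ?_, ?_⟩
  · change l j = Finsupp.single i 1 j
    rw [hl j hj.le, Finsupp.single_eq_of_ne hj.ne']
  · change l i < Finsupp.single i 1 i
    simp [hl i le_rfl]

/-- Two distinct inseparable points would give a sequence that alternates between them, hence
converges without being eventually constant. -/
lemma t0Space_of_eventuallyConst {H : Type u} [TopologicalSpace H]
    (hH : ∀ (x : ℕ → H) (a : H), Tendsto x atTop (𝓝 a) → EventuallyConst x atTop) :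
    T0Space H := by
  refine ⟨fun a b hab => ?_⟩
  let x : ℕ → H := fun n => if Even n then a else b
  have hx : Tendsto x atTop (𝓝 a) := by
    refine tendsto_def.2 fun s hs => Eventually.of_forall fun n => ?_
    by_cases hn : Even n
    · simpa [x, hn] using mem_of_mem_nhds hs
    · rw [hab.nhds_eq] at hs
      simpa [x, hn] using mem_of_mem_nhds hs
  obtain ⟨n, hn⟩ := eventuallyConst_atTop.1 (hH x a hx)
  have h1 := hn (2 * n) (by omega)
  have h2 := hn (2 * n + 1) (by omega)
  simpa [x] using h1.trans h2.symm

theorem mainTheorem10 (hTT : TT.{u}) :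
    ∃ (G : Type v) (_ : AddCommGroup G) (_ : TopologicalSpace G),
      ContinuousAdd G ∧ Module.Free ℤ G ∧ FunctionallyHausdorff G ∧ CountablyCompactSpace G ∧
        ¬ IsTopologicalAddGroup G ∧ ¬ LeftOmegaPrecompact G := by
  obtain ⟨H, _, _, _, _, _, _, hH⟩ := hTT
  have := t0Space_of_eventuallyConst hH
  obtain ⟨I, _, _, e, hI, he⟩ := exists_index.{v}
  obtain ⟨x, hx, hxe⟩ := exists_independent_clusterPt hI e hH
  have : Nonempty I := ⟨(he 0).choose⟩
  let c : Colex (I →₀ ℤ) ≃+ (I →₀ ℤ) := { ofColex with map_add' := fun _ _ => rfl }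
  have : Infinite (Colex (I →₀ ℤ)) := Infinite.of_injective c.symm c.symm.injective
  let φ : Colex (I →₀ ℤ) →+ H := (Finsupp.linearCombination ℤ x).toAddMonoidHom.comp c
  have hφ : Function.Injective φ := hx.comp c.injective
  have hcc := countablyCompactSpace_coneTopology φ hφ fun s hs => by
    obtain ⟨i, hi, hsi⟩ := he fun n => c (s n)
    refine ⟨toColex (Finsupp.single i 1), fun n => (toColex_lt_single (hsi n)).le, ?_⟩
    have := hxe i (hi ▸ c.injective.comp hs) (hi ▸ hsi)
    rw [hi] at this
    have hφi : φ (toColex (Finsupp.single i 1)) = x i := by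
      change Finsupp.linearCombination ℤ x (Finsupp.single i 1) = x i
      simp
    rw [hφi]
    exact this
  refine ⟨Colex (I →₀ ℤ), inferInstance, coneTopology φ, continuousAdd_coneTopology φ,
    Module.Free.of_equiv c.symm.toIntLinearEquiv, functionallyHausdorff_coneTopology φ hφ, hcc,
    not_isTopologicalAddGroup_coneTopology φ hcc,
    not_leftOmegaPrecompact_coneTopology φ fun s => ?_⟩
  obtain ⟨i, -, hsi⟩ := he fun n => c (s n)
  exact ⟨toColex (Finsupp.single i 1), fun n => toColex_lt_single (hsi n)⟩
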